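/- For a finite tree $T$, let $\mu_T$ denote the mean subtree order of $T$, that is, the average number of vertices of a subtree of $T$, taken over all (nonempty) subtrees of $T$. A pendant path of $T$ is a path in $T$ that starts at a leaf (a vertex of degree $1$) and all of whose interior vertices have degree $2$ in $T$. Let $T$ be a finite tree, let $e$ be an edge of $T$ that does not lie on any pendant path of $T$, and let $T^{*}$ be the tree obtained from $T$ by contracting $e$. Then $$\mu_T-\mu_{T^{*}}>\frac13 .$$ -/

import Mathlib

namespace SimpleGraph

variable {V : Type*}

/-- The subtrees of `G`: the subgraphs of `G` that are trees (in particular nonempty). -/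
def subtrees (G : SimpleGraph V) : Set G.Subgraph :=
  {H | H.coe.IsTree}

/-- The mean subtree order: the average number of vertices of the subtrees of `G`
(meant for a graph `G` on a finite vertex set). -/
noncomputable def meanSubtreeOrder (G : SimpleGraph V) : ℝ :=
  (∑ᶠ H ∈ G.subtrees, (H.verts.ncard : ℝ)) / (G.subtrees.ncard : ℝ)

/-- The equivalence relation on vertices that identifies the ends of `e` with each other
and nothing else. -/
def identifyEnds (e : Sym2 V) : Setoid V where
  r x y := x = y ∨ (x ∈ e ∧ y ∈ e)
  iseqv :=
    { refl := fun _ => Or.inl rfl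
      symm := by
        rintro x y (rfl | ⟨hx, hy⟩)
        · exact Or.inl rfl
        · exact Or.inr ⟨hy, hx⟩
      trans := by
        rintro x y z (rfl | ⟨hx, hy⟩) (rfl | ⟨hy', hz⟩)
        · exact Or.inl rfl
        · exact Or.inr ⟨hy', hz⟩
        · exact Or.inr ⟨hx, hy⟩
        · exact Or.inr ⟨hx, hz⟩ }

/-- The graph obtained from `G` by contracting `e`: the ends of `e` are merged into one vertex,
and two distinct vertices of the quotient are adjacent exactly when some representatives of them
are adjacent in `G`. -/
def contractEdge (G : SimpleGraph V) (e : Sym2 V) : SimpleGraph (Quotient (identifyEnds e)) :=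
  G.map (Quotient.mk (identifyEnds e))

/-- `e` lies on a pendant path of `G`: a path that starts at a leaf and
all of whose interior vertices have degree two. -/
def LiesOnPendantPath (G : SimpleGraph V) [G.LocallyFinite] (e : Sym2 V) : Prop :=
  ∃ (u w : V) (p : G.Walk u w), p.IsPath ∧ G.degree u = 1 ∧
    (∀ x ∈ p.support, x ≠ u → x ≠ w → G.degree x = 2) ∧ e ∈ p.edges

end SimpleGraph

/-! Deleting `e = ac` leaves a tree A rooted at a and a tree B rooted at c. In A let F, P be the
number and total order of the subtrees through the root, and G, Q those of the subtrees avoiding it;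
write f, p, g, q for B. The subtrees of `T*` correspond to the subtrees of `T` containing both or
neither of a, c. So `T*` has G + g + Ff subtrees, of total order Q + q + Pf + Fp - Ff, and `T` has F
+ f more subtrees and Ff + P + p more total order. Clearing denominators turns the claim into the
polynomial inequality `RootedBounds.contract_lt`.

That inequality follows from bounds on each rooted tree separately. They hold for one vertex and
survive joining two rooted trees by an edge at the root, which is `RootedBounds.extend` on one tree
followed by `RootedBounds.merge`; this gives `IsAcyclic.hasRootedBounds`. From `avoid_le` on, all
are equalities for a path rooted at an end.

Strictness comes from the slack Z = G + F² + 2F - 3P of `order_le`: if it vanishes, the rooted tree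
is such a path (`IsAcyclic.isPathRootedAt`), and then `e` lies on a pendant path. -/

/-! ### Polynomial inequalities for rooted trees. -/

/-- Inequalities for number `F` and total order `P` of the subtrees through the root and
number `G` and total order `Q` of the subtrees that avoid the root. -/
structure RootedBounds (F P G Q : ℝ) : Prop where
  one_le : 1 ≤ F
  nonneg : 0 ≤ G
  avoid_le : 2 * G ≤ F * (F - 1)
  le_order : F + G ≤ P
  order_le : 3 * P ≤ G + F ^ 2 + 2 * F
  total_le : 3 * (P + Q) ≤ (F + 2) * (F + G)
  -- For G > 0: the mean order P / F through the root exceeds the mean order Q / G off the root by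
  -- at least (F + G) / (3F).
  mean_le : 3 * (F * Q) + G * (G + F) ≤ 3 * (G * P)

/-- The effect of hanging the tree below a new root: the new root may stand alone or be added to a
rooted subtree, and every old subtree now avoids the root. The slack Z is unchanged. -/
theorem RootedBounds.extend {F P G Q : ℝ} (h : RootedBounds F P G Q) :
    RootedBounds (F + 1) (P + F + 1) (G + F) (Q + P) := by
  obtain ⟨h1, h2, h3, h4, h5, h6, h7⟩ := h
  constructor <;> nlinarith

/-- A lower bound for Z after two roots are identified. The last summand on the left is positive
when F, f > 1, so Z = 0 then forces one of the trees to be trivial. -/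
theorem RootedBounds.merge_order_le {F P G Q f p g q : ℝ} (h : RootedBounds F P G Q)
    (h' : RootedBounds f p g q) :
    f * (G + F ^ 2 + 2 * F - 3 * P) + F * (g + f ^ 2 + 2 * f - 3 * p)
      + (F - 1) * (f - 1) * (F * f - F / 2 - f / 2)
      ≤ (G + g) + (F * f) ^ 2 + 2 * (F * f) - 3 * (P * f + F * p - F * f) := by
  obtain ⟨h1, h2, h3, h4, h5, h6, h7⟩ := h
  obtain ⟨k1, k2, k3, k4, k5, k6, k7⟩ := h'
  nlinarith [mul_nonneg (sub_nonneg.2 h3) (sub_nonneg.2 k1),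
    mul_nonneg (sub_nonneg.2 k3) (sub_nonneg.2 h1)]

/-- Identifying the roots: rooted subtrees are pairs of rooted subtrees, whose orders add up with
the root counted twice. -/
theorem RootedBounds.merge {F P G Q f p g q : ℝ} (h : RootedBounds F P G Q)
    (h' : RootedBounds f p g q) :
    RootedBounds (F * f) (P * f + F * p - F * f) (G + g) (Q + q) := by
  have hZ := h.merge_order_le h'
  obtain ⟨h1, h2, h3, h4, h5, h6, h7⟩ := h
  obtain ⟨k1, k2, k3, k4, k5, k6, k7⟩ := h'
  have hF := sub_nonneg.2 h1
  have hf := sub_nonneg.2 k1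
  have e1 : 0 ≤ (F - 1) * (f - 1) := mul_nonneg hF hf
  have e2 : 0 ≤ F * f - F / 2 - f / 2 := by nlinarith
  have e3 := mul_nonneg e1 e2
  have z1 : 0 ≤ G + F ^ 2 + 2 * F - 3 * P := by linarith
  have z2 : 0 ≤ g + f ^ 2 + 2 * f - 3 * p := by linarith
  have e4 := mul_nonneg hf z1
  have e5 := mul_nonneg hF z2
  have hGf := mul_nonneg h2 hf
  have hgF := mul_nonneg k2 hF
  have hF0 : 0 ≤ F := by linarith
  have hf0 : 0 ≤ f := by linarith
  refine ⟨by nlinarith, by linarith, ?_, ?_, ?_, ?_, ?_⟩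
  · have : 0 ≤ (F - 1) * (f - 1) * (3 + (F - 1) * (f - 1) + 2 * (F - 1) + 2 * (f - 1)) :=
      mul_nonneg e1 (by linarith)
    linarith
  · have c1 := mul_nonneg hf0 (sub_nonneg.2 h4)
    have c2 := mul_nonneg hF0 (sub_nonneg.2 k4)
    linarith
  · linarith
  · have c1 := mul_nonneg hGf hF0
    have c2 := mul_nonneg hgF hf0
    linarith
  · set Z := G + F ^ 2 + 2 * F - 3 * P with hZd
    set z := g + f ^ 2 + 2 * f - 3 * p with hzd
    -- The slack of `mean_le` equals F times the slack of `total_le` minus (F + G) Z; this is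
    -- `mean_le` in that form.
    have a1 : f * (G * Z) ≤ f * (F * ((F + 2) * (F + G) - 3 * (P + Q) - Z)) := by
      refine mul_le_mul_of_nonneg_left ?_ hf0
      rw [hZd]; nlinarith
    have a2 : F * (g * z) ≤ F * (f * ((f + 2) * (f + g) - 3 * (p + q) - z)) := by
      refine mul_le_mul_of_nonneg_left ?_ hF0
      rw [hzd]; nlinarith
    -- Z ≤ F² - F - 2G is `le_order` rewritten.
    have a3 : g * (f * Z) ≤ g * (f * (F ^ 2 - F - 2 * G)) := by
      refine mul_le_mul_of_nonneg_left (mul_le_mul_of_nonneg_left ?_ hf0) k2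
      rw [hZd]; linarith
    have a4 : G * (F * z) ≤ G * (F * (f ^ 2 - f - 2 * g)) := by
      refine mul_le_mul_of_nonneg_left (mul_le_mul_of_nonneg_left ?_ hF0) h2
      rw [hzd]; linarith
    have a5 : 0 ≤ (G + g) * (G * (f - 1) + g * (F - 1)) :=
      mul_nonneg (by linarith) (by linarith)
    have a6 : 0 ≤ g * f * G := by positivity
    have a7 : 0 ≤ g * F * G := by positivity
    rw [hZd] at a1 a3
    rw [hzd] at a2 a4
    linarith

theorem RootedBounds.contract_lt {F P G Q f p g q : ℝ} (h : RootedBounds F P G Q)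
    (h' : RootedBounds f p g q) (hZ : 3 * P < G + F ^ 2 + 2 * F) (hf : 1 < f) :
    ((G + g + F * f) + F + f) * (G + g + F * f)  <
      3 * ((F * f + P + p) * (G + g + F * f)
        - (Q + q + P * f + F * p - F * f) * (F + f)) := by
  obtain ⟨h1, h2, h3, h4, h5, h6, h7⟩ := h
  obtain ⟨k1, k2, k3, k4, k5, k6, k7⟩ := h'
  -- The two sides of the goal differ by exactly the sum of these four products and the slacks of
  -- the two `mean_le`.
  have b1 : 0 ≤ f * ((F + 2) * (F + G) - 3 * (P + Q)) := mul_nonneg (by linarith) (by linarith)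
  have b2 : 0 ≤ F * ((f + 2) * (f + g) - 3 * (p + q)) := mul_nonneg (by linarith) (by linarith)
  have b3 : 0 < (G + F ^ 2 + 2 * F - 3 * P) * (f ^ 2 - g - f) :=
    mul_pos (by linarith) (by nlinarith)
  have b4 : 0 ≤ (g + f ^ 2 + 2 * f - 3 * p) * (F ^ 2 - G - F) :=
    mul_nonneg (by linarith) (by nlinarith)
  linarith

namespace SimpleGraph

/-! ### Connected vertex sets in place of subtrees. -/

section ConnectedOn

variable {V W : Type*} {G : SimpleGraph V}

/-- A nonempty set of vertices that induces a connected subgraph, expressed through cuts. -/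
def ConnectedOn (G : SimpleGraph V) (S : Set V) : Prop :=
  S.Nonempty ∧ ∀ X : Set V, (∃ x ∈ S, x ∈ X) →
    (∀ x ∈ S, x ∈ X → ∀ y ∈ S, G.Adj x y → y ∈ X) → S ⊆ X

theorem connectedOn_singleton (a : V) : G.ConnectedOn {a} := by
  refine ⟨⟨a, rfl⟩, fun X ⟨x, hx, hX⟩ _ y hy => ?_⟩
  rw [Set.mem_singleton_iff] at hx hy
  rwa [hy, ← hx]

theorem ConnectedOn.image {G' : SimpleGraph W} {S : Set V} (hS : G.ConnectedOn S) (f : V → W)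
    (hf : ∀ x ∈ S, ∀ y ∈ S, G.Adj x y → f x = f y ∨ G'.Adj (f x) (f y)) :
    G'.ConnectedOn (f '' S) := by
  refine ⟨hS.1.image f, fun X ⟨x, ⟨v, hv, hvx⟩, hX⟩ hcl => ?_⟩
  rw [Set.image_subset_iff]
  refine hS.2 _ ⟨v, hv, by rwa [Set.mem_preimage, hvx]⟩ fun x hx hxX y hy hxy => ?_
  rcases hf x hx y hy hxy with h | h
  · rwa [Set.mem_preimage, ← h]
  · exact hcl _ ⟨x, hx, rfl⟩ hxX _ ⟨y, hy, rfl⟩ h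

theorem ConnectedOn.union {S S' : Set V} (hS : G.ConnectedOn S) (hS' : G.ConnectedOn S')
    {a c : V} (ha : a ∈ S) (hc : c ∈ S') (hac : G.Adj a c) : G.ConnectedOn (S ∪ S') := by
  refine ⟨hS.1.inl, fun X ⟨x, hx, hX⟩ hcl => ?_⟩
  have h1 : (∃ x ∈ S, x ∈ X) → S ⊆ X := fun h => hS.2 X h
    fun x hx hxX y hy hxy => hcl x (Or.inl hx) hxX y (Or.inl hy) hxy
  have h2 : (∃ x ∈ S', x ∈ X) → S' ⊆ X := fun h => hS'.2 X h
    fun x hx hxX y hy hxy => hcl x (Or.inr hx) hxX y (Or.inr hy) hxy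
  rcases hx with hx | hx
  · have h := h1 ⟨x, hx, hX⟩
    exact Set.union_subset h (h2 ⟨c, hc, hcl a (Or.inl ha) (h ha) c (Or.inr hc) hac⟩)
  · have h := h2 ⟨x, hx, hX⟩
    exact Set.union_subset (h1 ⟨a, ha, hcl c (Or.inr hc) (h hc) a (Or.inl ha) hac.symm⟩) h

theorem Connected.connectedOn_verts {H : G.Subgraph} (h : H.coe.Connected) :
    G.ConnectedOn H.verts := by
  obtain ⟨x⟩ := h.nonempty
  refine ⟨⟨x, x.2⟩, fun X ⟨y, hy, hX⟩ hcl z hz => ?_⟩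
  obtain ⟨p⟩ := h.preconnected ⟨y, hy⟩ ⟨z, hz⟩
  have key : ∀ (u v : H.verts), H.coe.Walk u v → (u : V) ∈ X → (v : V) ∈ X := by
    intro u v p
    induction p with
    | nil => exact id
    | @cons u v w hadj _ ih =>
      exact fun hu => ih (hcl u u.2 hu v v.2 (H.adj_sub hadj))
  exact key _ _ p hX

theorem ConnectedOn.connected_induce {S : Set V} (h : G.ConnectedOn S) :
    ((⊤ : G.Subgraph).induce S).coe.Connected := by
  obtain ⟨x, hx⟩ := h.1
  have key : ∀ y : ((⊤ : G.Subgraph).induce S).verts,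
      ((⊤ : G.Subgraph).induce S).coe.Reachable ⟨x, hx⟩ y := by
    have := h.2 {y | ∃ hy : y ∈ S, ((⊤ : G.Subgraph).induce S).coe.Reachable ⟨x, hx⟩ ⟨y, hy⟩}
      ⟨x, hx, hx, Reachable.refl _⟩ ?_
    · exact fun y => (this y.2).2
    · rintro u hu ⟨_, hr⟩ v hv huv
      refine ⟨hv, hr.trans (Adj.reachable ?_)⟩
      exact ⟨hu, hv, huv⟩
  have : Nonempty ((⊤ : G.Subgraph).induce S).verts := ⟨⟨x, hx⟩⟩
  exact ⟨fun u v => (key u).symm.trans (key v)⟩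

theorem Connected.connectedOn_univ (h : G.Connected) : G.ConnectedOn Set.univ := by
  obtain ⟨x⟩ := h.nonempty
  refine ⟨⟨x, trivial⟩, fun X ⟨y, _, hX⟩ hcl z _ => ?_⟩
  obtain ⟨p⟩ := h.preconnected y z
  induction p with
  | nil => exact hX
  | cons hadj _ ih => exact ih trivial trivial (hcl _ trivial hX _ trivial hadj)

theorem ConnectedOn.connected (h : G.ConnectedOn Set.univ) : G.Connected := by
  obtain ⟨x, _⟩ := h.1
  have key : ∀ y, G.Reachable x y := fun y =>
    h.2 {y | G.Reachable x y} ⟨x, trivial, Reachable.refl _⟩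
      (fun u _ hr v _ huv => hr.trans huv.reachable) (Set.mem_univ y)
  have : Nonempty V := ⟨x⟩
  exact ⟨fun u v => (key u).symm.trans (key v)⟩

/-- A missing edge uv would be a bridge of `G`, yet `H` joins u to v without it. -/
theorem IsAcyclic.eq_induce_verts (hG : G.IsAcyclic) {H : G.Subgraph} (h : H.coe.Connected) :
    (⊤ : G.Subgraph).induce H.verts = H := by
  refine Subgraph.ext rfl ?_
  ext u v
  rw [Subgraph.induce_adj]
  refine ⟨fun ⟨hu, hv, huv⟩ => ?_, fun h => ⟨h.fst_mem, h.snd_mem, H.adj_sub h⟩⟩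
  by_contra hn
  have hb := isBridge_iff.1 (isAcyclic_iff_forall_adj_isBridge.1 hG huv)
  refine hb ((h.preconnected ⟨u, hu⟩ ⟨v, hv⟩).map
    (⟨Subtype.val, fun {x y} hxy => ?_⟩ : H.coe →g G.deleteEdges {s(u, v)}))
  rw [deleteEdges_adj]
  refine ⟨H.adj_sub hxy, fun he => hn ?_⟩
  have : s(u, v) ∈ H.edgeSet := Set.mem_singleton_iff.1 he ▸ Subgraph.mem_edgeSet.2 hxy
  exact Subgraph.mem_edgeSet.1 this

end ConnectedOn

/-! ### Splitting a connected set along one edge. -/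

section EdgeCut

variable {V : Type*} {G : SimpleGraph V} {D : Set V} {a c : V}

/-- The edge `ac` is the only edge between the complement of `D` and `D`. -/
structure IsEdgeCut (G : SimpleGraph V) (D : Set V) (a c : V) : Prop where
  adj : G.Adj a c
  notMem : a ∉ D
  mem : c ∈ D
  eq_of_adj : ∀ x ∉ D, ∀ y ∈ D, G.Adj x y → x = a ∧ y = c

theorem IsEdgeCut.symm (h : G.IsEdgeCut D a c) : G.IsEdgeCut Dᶜ c a :=
  ⟨h.adj.symm, fun hn => hn h.mem, h.notMem, fun x hx y hy hxy =>
    (h.eq_of_adj y hy x (not_not.1 hx) hxy.symm).symm⟩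

theorem IsAcyclic.exists_isEdgeCut (hG : G.IsAcyclic) (h : G.Adj a c) :
    ∃ D, G.IsEdgeCut D a c := by
  have hb := isBridge_iff.1 (isAcyclic_iff_forall_adj_isBridge.1 hG h)
  refine ⟨{x | (G.deleteEdges {s(a, c)}).Reachable x c}, h, hb, Reachable.refl _,
    fun x hx y hy hxy => ?_⟩
  by_cases he : s(x, y) = s(a, c)
  · rcases Sym2.eq_iff.1 he with h | ⟨-, rfl⟩
    · exact h
    · exact absurd hy hb
  · exact absurd ((deleteEdges_adj.2 ⟨hxy, he⟩ : (G.deleteEdges {s(a, c)}).Adj x y).reachable.trans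
      hy) hx

theorem ConnectedOn.mem_of_isEdgeCut {S : Set V} (hS : G.ConnectedOn S) (h : G.IsEdgeCut D a c)
    {x y : V} (hx : x ∈ S) (hxD : x ∉ D) (hy : y ∈ S) (hyD : y ∈ D) : a ∈ S ∧ c ∈ S := by
  by_contra hn
  refine hxD (hS.2 D ⟨y, hy, hyD⟩ (fun u hu huD v hv huv => ?_) hx)
  by_contra hvD
  obtain ⟨rfl, rfl⟩ := h.eq_of_adj v hvD u huD huv.symm
  exact hn ⟨hv, hu⟩

open scoped Classical in
theorem ConnectedOn.diff {S : Set V} (hS : G.ConnectedOn S) (h : G.IsEdgeCut D a c) (ha : a ∈ S) :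
    G.ConnectedOn (S \ D) := by
  -- S \ D is the image of S under the retraction that collapses D to a.
  have := hS.image (G' := G) (fun x => if x ∈ D then a else x) ?_
  · convert this using 1
    ext x
    constructor
    · exact fun hx => ⟨x, hx.1, if_neg hx.2⟩
    · rintro ⟨y, hy, rfl⟩
      dsimp only
      split_ifs with hyD
      · exact ⟨ha, h.notMem⟩
      · exact ⟨hy, hyD⟩
  · intro x _ y _ hxy
    by_cases hx : x ∈ D <;> by_cases hy : y ∈ D <;> simp only [hx, hy, if_true, if_false]
    · exact Or.inl trivial
    · exact Or.inl (h.eq_of_adj y hy x hx hxy.symm).1.symm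
    · exact Or.inl (h.eq_of_adj x hx y hy hxy).1
    · exact Or.inr hxy

theorem ConnectedOn.inter {S : Set V} (hS : G.ConnectedOn S) (h : G.IsEdgeCut D a c) (hc : c ∈ S) :
    G.ConnectedOn (S ∩ D) := by
  have := hS.diff h.symm hc
  rwa [Set.sdiff_compl] at this

end EdgeCut

/-! ### Sums over the connected sets of two pieces joined by an edge. -/

section Families

open scoped Classical

variable {V : Type*} {G : SimpleGraph V} {D : Set V} {a c : V}

/-- The connected sets of vertices inside `U`. -/
noncomputable def connSets (G : SimpleGraph V) (U : Finset V) : Finset (Finset V) :=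
  U.powerset.filter fun S => G.ConnectedOn (S : Set V)

/-- The connected sets inside `U` that contain `a`. -/
noncomputable def rootedSets (G : SimpleGraph V) (U : Finset V) (a : V) : Finset (Finset V) :=
  (G.connSets U).filter fun S => a ∈ S

/-- The connected sets inside `U` that avoid `a`. -/
noncomputable def avoidSets (G : SimpleGraph V) (U : Finset V) (a : V) : Finset (Finset V) :=
  (G.connSets U).filter fun S => a ∉ S

theorem mem_connSets {U S : Finset V} :
    S ∈ G.connSets U ↔ S ⊆ U ∧ G.ConnectedOn (S : Set V) := by
  simp [connSets]

theorem mem_rootedSets {U S : Finset V} :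
    S ∈ G.rootedSets U a ↔ (S ⊆ U ∧ G.ConnectedOn (S : Set V)) ∧ a ∈ S := by
  simp [rootedSets, mem_connSets]

theorem sum_rootedSets_add_sum_avoidSets (U : Finset V) (a : V) (h : Finset V → ℝ) :
    ∑ S ∈ G.rootedSets U a, h S + ∑ S ∈ G.avoidSets U a, h S = ∑ S ∈ G.connSets U, h S :=
  Finset.sum_filter_add_sum_filter_not _ _ _

theorem IsEdgeCut.connSets_union (hD : G.IsEdgeCut D a c) {U₁ U₂ : Finset V}
    (h₁ : ∀ x ∈ U₁, x ∉ D) (h₂ : ∀ x ∈ U₂, x ∈ D) :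
    G.connSets (U₁ ∪ U₂) = G.connSets U₁ ∪ G.connSets U₂ ∪
      (G.rootedSets U₁ a ×ˢ G.rootedSets U₂ c).image fun p => p.1 ∪ p.2 := by
  ext S
  simp only [Finset.mem_union, Finset.mem_image, Finset.mem_product, mem_connSets,
    mem_rootedSets, Prod.exists]
  constructor
  · rintro ⟨hSU, hS⟩
    by_cases hx : ∃ x ∈ S, x ∉ D
    · by_cases hy : ∃ y ∈ S, y ∈ D
      · obtain ⟨x, hx, hxD⟩ := hx
        obtain ⟨y, hy, hyD⟩ := hy
        obtain ⟨ha, hc⟩ := hS.mem_of_isEdgeCut hD (Finset.mem_coe.2 hx) hxD (Finset.mem_coe.2 hy) hyD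
        refine Or.inr ⟨S.filter (· ∉ D), S.filter (· ∈ D), ⟨⟨⟨?_, ?_⟩, ?_⟩, ⟨?_, ?_⟩, ?_⟩, ?_⟩
        · intro z hz
          rw [Finset.mem_filter] at hz
          exact (Finset.mem_union.1 (hSU hz.1)).resolve_right fun h => hz.2 (h₂ z h)
        · convert hS.diff hD ha using 1
          ext z; simp
        · exact Finset.mem_filter.2 ⟨ha, hD.notMem⟩
        · intro z hz
          rw [Finset.mem_filter] at hz
          exact (Finset.mem_union.1 (hSU hz.1)).resolve_left fun h => h₁ z h hz.2
        · convert hS.inter hD hc using 1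
          ext z; simp
        · exact Finset.mem_filter.2 ⟨hc, hD.mem⟩
        · rw [Finset.union_comm, Finset.filter_union_filter_not_eq]
      · refine Or.inl (Or.inl ⟨fun z hz => ?_, hS⟩)
        exact (Finset.mem_union.1 (hSU hz)).resolve_right fun h => hy ⟨z, hz, h₂ z h⟩
    · refine Or.inl (Or.inr ⟨fun z hz => ?_, hS⟩)
      exact (Finset.mem_union.1 (hSU hz)).resolve_left fun h => hx ⟨z, hz, h₁ z h⟩
  · rintro ((⟨h, hS⟩ | ⟨h, hS⟩) | ⟨S₁, S₂, ⟨⟨⟨h, hS₁⟩, ha⟩, ⟨h', hS₂⟩, hc⟩, rfl⟩)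
    · exact ⟨h.trans Finset.subset_union_left, hS⟩
    · exact ⟨h.trans Finset.subset_union_right, hS⟩
    · refine ⟨Finset.union_subset_union h h', ?_⟩
      rw [Finset.coe_union]
      exact hS₁.union hS₂ ha hc hD.adj

theorem IsEdgeCut.sum_connSets_union (hD : G.IsEdgeCut D a c) {U₁ U₂ : Finset V}
    (h₁ : ∀ x ∈ U₁, x ∉ D) (h₂ : ∀ x ∈ U₂, x ∈ D) (h : Finset V → ℝ) :
    ∑ S ∈ G.connSets (U₁ ∪ U₂), h S = ∑ S ∈ G.connSets U₁, h S + ∑ S ∈ G.connSets U₂, h S +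
      ∑ S ∈ G.rootedSets U₁ a, ∑ S' ∈ G.rootedSets U₂ c, h (S ∪ S') := by
  rw [hD.connSets_union h₁ h₂, Finset.sum_union, Finset.sum_union, Finset.sum_image,
    Finset.sum_product]
  · have aux : ∀ S₁ S₂ : Finset V, S₁ ⊆ U₁ → S₂ ⊆ U₂ →
        S₁ = (S₁ ∪ S₂).filter (· ∉ D) ∧ S₂ = (S₁ ∪ S₂).filter (· ∈ D) := by
      intro S₁ S₂ h h'
      constructor <;> ext z <;> simp only [Finset.mem_filter, Finset.mem_union]
      · exact ⟨fun hz => ⟨Or.inl hz, h₁ z (h hz)⟩,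
          fun hz => hz.1.resolve_right fun hz' => hz.2 (h₂ z (h' hz'))⟩
      · exact ⟨fun hz => ⟨Or.inr hz, h₂ z (h' hz)⟩,
          fun hz => hz.1.resolve_left fun hz' => h₁ z (h hz') hz.2⟩
    rintro ⟨S₁, S₂⟩ hS ⟨S₁', S₂'⟩ hS' heq
    simp only [Finset.coe_product, Set.mem_prod, Finset.mem_coe, mem_rootedSets] at hS hS' heq
    have e := aux S₁ S₂ hS.1.1.1 hS.2.1.1
    have e' := aux S₁' S₂' hS'.1.1.1 hS'.2.1.1
    rw [heq] at e
    exact Prod.ext (e.1.trans e'.1.symm) (e.2.trans e'.2.symm)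
  · rw [Finset.disjoint_left]
    intro S hS hS'
    rw [mem_connSets] at hS hS'
    obtain ⟨x, hx⟩ := hS.2.1
    exact h₁ x (hS.1 hx) (h₂ x (hS'.1 hx))
  · rw [Finset.disjoint_left]
    intro S hS hS'
    simp only [Finset.mem_image, Finset.mem_product, mem_rootedSets, Prod.exists] at hS'
    obtain ⟨S₁, S₂, ⟨⟨-, ha⟩, -, hc⟩, rfl⟩ := hS'
    rw [Finset.mem_union, mem_connSets, mem_connSets] at hS
    rcases hS with hS | hS
    · exact h₁ c (hS.1 (Finset.mem_union_right _ hc)) hD.mem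
    · exact hD.notMem (h₂ a (hS.1 (Finset.mem_union_left _ ha)))

theorem IsEdgeCut.sum_rootedSets_union (hD : G.IsEdgeCut D a c) {U₁ U₂ : Finset V}
    (h₁ : ∀ x ∈ U₁, x ∉ D) (h₂ : ∀ x ∈ U₂, x ∈ D) (h : Finset V → ℝ) :
    ∑ S ∈ G.rootedSets (U₁ ∪ U₂) a, h S = ∑ S ∈ G.rootedSets U₁ a, h S +
      ∑ S ∈ G.rootedSets U₁ a, ∑ S' ∈ G.rootedSets U₂ c, h (S ∪ S') := by
  rw [rootedSets, Finset.sum_filter, hD.sum_connSets_union h₁ h₂]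
  have e : ∑ S ∈ G.connSets U₂, (if a ∈ S then h S else 0) = 0 :=
    Finset.sum_eq_zero fun S hS => if_neg fun ha =>
      hD.notMem (h₂ a ((mem_connSets.1 hS).1 ha))
  rw [e, add_zero, ← Finset.sum_filter, ← rootedSets]
  congr 1
  refine Finset.sum_congr rfl fun S hS => Finset.sum_congr rfl fun S' _ => if_pos ?_
  exact Finset.mem_union_left _ (mem_rootedSets.1 hS).2

theorem IsEdgeCut.sum_avoidSets_union (hD : G.IsEdgeCut D a c) {U₁ U₂ : Finset V}
    (h₁ : ∀ x ∈ U₁, x ∉ D) (h₂ : ∀ x ∈ U₂, x ∈ D) (h : Finset V → ℝ) :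
    ∑ S ∈ G.avoidSets (U₁ ∪ U₂) a, h S = ∑ S ∈ G.avoidSets U₁ a, h S +
      (∑ S ∈ G.rootedSets U₂ c, h S + ∑ S ∈ G.avoidSets U₂ c, h S) := by
  have e := sum_rootedSets_add_sum_avoidSets (G := G) (U₁ ∪ U₂) a h
  have e₁ := sum_rootedSets_add_sum_avoidSets (G := G) U₁ a h
  have e₂ := sum_rootedSets_add_sum_avoidSets (G := G) U₂ c h
  rw [hD.sum_connSets_union h₁ h₂] at e
  rw [hD.sum_rootedSets_union h₁ h₂] at e
  linarith

end Families

end SimpleGraph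

namespace SimpleGraph

/-! ### Bounds for rooted trees and the equality case. -/

section Rooted

open scoped Classical

variable {V : Type*} {G : SimpleGraph V} {D : Set V} {a c : V} {U U₁ U₂ : Finset V}

theorem IsEdgeCut.card_rootedSets_union (hD : G.IsEdgeCut D a c)
    (h₁ : ∀ x ∈ U₁, x ∉ D) (h₂ : ∀ x ∈ U₂, x ∈ D) :
    ((G.rootedSets (U₁ ∪ U₂) a).card : ℝ) = (G.rootedSets U₁ a).card
      + (G.rootedSets U₁ a).card * (G.rootedSets U₂ c).card := by
  have := hD.sum_rootedSets_union h₁ h₂ (fun _ => 1)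
  simpa using this

theorem IsEdgeCut.card_avoidSets_union (hD : G.IsEdgeCut D a c)
    (h₁ : ∀ x ∈ U₁, x ∉ D) (h₂ : ∀ x ∈ U₂, x ∈ D) :
    ((G.avoidSets (U₁ ∪ U₂) a).card : ℝ) = (G.avoidSets U₁ a).card
      + ((G.rootedSets U₂ c).card + (G.avoidSets U₂ c).card) := by
  have := hD.sum_avoidSets_union h₁ h₂ (fun _ => 1)
  simpa using this

theorem sum_rootedSets_card_union (h₁ : ∀ x ∈ U₁, x ∉ D) (h₂ : ∀ x ∈ U₂, x ∈ D) :
    ∑ S ∈ G.rootedSets U₁ a, ∑ S' ∈ G.rootedSets U₂ c, ((S ∪ S').card : ℝ)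
      = (∑ S ∈ G.rootedSets U₁ a, (S.card : ℝ)) * (G.rootedSets U₂ c).card
        + (G.rootedSets U₁ a).card * ∑ S ∈ G.rootedSets U₂ c, (S.card : ℝ) := by
  rw [Finset.sum_mul, ← nsmul_eq_mul, ← Finset.sum_const, ← Finset.sum_add_distrib]
  refine Finset.sum_congr rfl fun S hS => ?_
  rw [mul_comm, ← nsmul_eq_mul, ← Finset.sum_const, ← Finset.sum_add_distrib]
  refine Finset.sum_congr rfl fun S' hS' => ?_
  rw [Finset.card_union_of_disjoint, Nat.cast_add]
  rw [Finset.disjoint_left]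
  exact fun x hx hx' => h₁ x ((mem_rootedSets.1 hS).1.1 hx) (h₂ x ((mem_rootedSets.1 hS').1.1 hx'))

theorem IsEdgeCut.order_rootedSets_union (hD : G.IsEdgeCut D a c)
    (h₁ : ∀ x ∈ U₁, x ∉ D) (h₂ : ∀ x ∈ U₂, x ∈ D) :
    ∑ S ∈ G.rootedSets (U₁ ∪ U₂) a, (S.card : ℝ) = ∑ S ∈ G.rootedSets U₁ a, (S.card : ℝ)
      + ((∑ S ∈ G.rootedSets U₁ a, (S.card : ℝ)) * (G.rootedSets U₂ c).card
        + (G.rootedSets U₁ a).card * ∑ S ∈ G.rootedSets U₂ c, (S.card : ℝ)) := by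
  rw [hD.sum_rootedSets_union h₁ h₂, sum_rootedSets_card_union h₁ h₂]

/-- `RootedBounds` for the counts of connected sets in `U` rooted at `a`. -/
def HasRootedBounds (G : SimpleGraph V) (U : Finset V) (a : V) : Prop :=
  RootedBounds (G.rootedSets U a).card (∑ S ∈ G.rootedSets U a, (S.card : ℝ))
    (G.avoidSets U a).card (∑ S ∈ G.avoidSets U a, (S.card : ℝ))

theorem rootedSets_singleton (a : V) : G.rootedSets {a} a = {{a}} := by
  ext S
  rw [mem_rootedSets, Finset.mem_singleton]
  constructor
  · rintro ⟨⟨h, -⟩, ha⟩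
    exact h.antisymm (Finset.singleton_subset_iff.2 ha)
  · rintro rfl
    refine ⟨⟨subset_rfl, ?_⟩, Finset.mem_singleton_self a⟩
    rw [Finset.coe_singleton]
    exact connectedOn_singleton a

theorem avoidSets_singleton (a : V) : G.avoidSets {a} a = ∅ := by
  rw [avoidSets, Finset.filter_eq_empty_iff]
  intro S hS ha
  rw [mem_connSets] at hS
  obtain ⟨x, hx⟩ := hS.2.1
  exact ha (Finset.mem_singleton.1 (hS.1 hx) ▸ hx)

/-- Induction over connected sets with a root: a set with more than one vertex is split along an
edge at the root. -/
theorem IsAcyclic.rooted_induction (hG : G.IsAcyclic) {motive : Finset V → V → Prop}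
    (singleton : ∀ a, motive {a} a)
    (union : ∀ (D : Set V) (a c : V) (U₁ U₂ : Finset V), G.IsEdgeCut D a c →
      (∀ x ∈ U₁, x ∉ D) → (∀ x ∈ U₂, x ∈ D) → a ∈ U₁ → c ∈ U₂ →
      G.ConnectedOn (U₁ : Set V) → G.ConnectedOn (U₂ : Set V) →
      motive U₁ a → motive U₂ c → motive (U₁ ∪ U₂) a)
    (U : Finset V) (a : V) (hU : G.ConnectedOn (U : Set V)) (ha : a ∈ U) : motive U a := by
  induction U using Finset.strongInduction generalizing a with
  | H U ih =>
    by_cases hex : ∃ c ∈ U, G.Adj a c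
    · obtain ⟨c, hc, hac⟩ := hex
      obtain ⟨D, hD⟩ := hG.exists_isEdgeCut hac
      have e : U.filter (· ∉ D) ∪ U.filter (· ∈ D) = U := by
        rw [Finset.union_comm, Finset.filter_union_filter_not_eq]
      have c₁ : G.ConnectedOn (U.filter (· ∉ D) : Set V) := by
        convert hU.diff hD ha using 1
        ext z; simp
      have c₂ : G.ConnectedOn (U.filter (· ∈ D) : Set V) := by
        convert hU.inter hD hc using 1
        ext z; simp
      have ha' : a ∈ U.filter (· ∉ D) := Finset.mem_filter.2 ⟨ha, hD.notMem⟩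
      have hc' : c ∈ U.filter (· ∈ D) := Finset.mem_filter.2 ⟨hc, hD.mem⟩
      rw [← e]
      refine union D a c _ _ hD (fun x hx => (Finset.mem_filter.1 hx).2)
        (fun x hx => (Finset.mem_filter.1 hx).2) ha' hc' c₁ c₂ (ih _ ?_ a c₁ ha') (ih _ ?_ c c₂ hc')
      · exact Finset.filter_ssubset.2 ⟨c, hc, not_not.2 hD.mem⟩
      · exact Finset.filter_ssubset.2 ⟨a, ha, hD.notMem⟩
    · have : U = {a} := by
        refine Finset.Subset.antisymm (fun x hx => ?_) (Finset.singleton_subset_iff.2 ha)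
        have := hU.2 {a} ⟨a, ha, rfl⟩ (fun x _ hxa y hy hxy => ?_) hx
        · exact Finset.mem_singleton.2 this
        · rw [Set.mem_singleton_iff.1 hxa] at hxy
          exact absurd ⟨y, hy, hxy⟩ hex
      rw [this]
      exact singleton a

theorem IsAcyclic.hasRootedBounds (hG : G.IsAcyclic) (hU : G.ConnectedOn (U : Set V))
    (ha : a ∈ U) : G.HasRootedBounds U a := by
  refine hG.rooted_induction (motive := G.HasRootedBounds) ?_ ?_ U a hU ha
  · intro a
    rw [HasRootedBounds, rootedSets_singleton, avoidSets_singleton]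
    constructor <;> norm_num
  · intro D a c U₁ U₂ hD h₁ h₂ _ _ _ _ ih₁ ih₂
    rw [HasRootedBounds, hD.card_rootedSets_union h₁ h₂, hD.order_rootedSets_union h₁ h₂,
      hD.card_avoidSets_union h₁ h₂, hD.sum_avoidSets_union h₁ h₂]
    rw [HasRootedBounds] at ih₁ ih₂
    -- Joining along ac means hanging `U₂` below a copy of a and identifying the copies.
    convert ih₁.merge ih₂.extend using 1 <;> ring

theorem eq_singleton_of_card_rootedSets_le (hU : G.ConnectedOn (U : Set V)) (ha : a ∈ U)
    (h : (G.rootedSets U a).card ≤ 1) : U = {a} := by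
  refine Finset.card_le_one.1 h _ (mem_rootedSets.2 ⟨⟨subset_rfl, hU⟩, ha⟩) _
    (mem_rootedSets.2 ⟨⟨Finset.singleton_subset_iff.2 ha, ?_⟩, Finset.mem_singleton_self a⟩)
  rw [Finset.coe_singleton]
  exact connectedOn_singleton a

/-- `U` is the vertex set of an induced path with ends `u` and `a`. -/
def IsPathRootedAt (G : SimpleGraph V) (U : Finset V) (a : V) : Prop :=
  ∃ (u : V) (p : G.Walk u a), p.IsPath ∧ (∀ x ∈ p.support, x ∈ U) ∧
    -- The two corrections make the degree 1 at distinct ends, and 0 when u = a.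
    ∀ x ∈ U, (U.filter fun y => G.Adj x y).card + (if x = u then 1 else 0)
      + (if x = a then 1 else 0) = 2

/-- Vanishing Z forces the piece at the root to be the root alone and Z to vanish for the other
piece, so the path grows by one vertex at a time. -/
theorem IsAcyclic.isPathRootedAt (hG : G.IsAcyclic) (hU : G.ConnectedOn (U : Set V))
    (ha : a ∈ U) (h : ((G.avoidSets U a).card : ℝ) + ((G.rootedSets U a).card : ℝ) ^ 2
      + 2 * (G.rootedSets U a).card ≤ 3 * ∑ S ∈ G.rootedSets U a, (S.card : ℝ)) :
    G.IsPathRootedAt U a := by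
  refine hG.rooted_induction (motive := fun U a => ((G.avoidSets U a).card : ℝ)
    + ((G.rootedSets U a).card : ℝ) ^ 2 + 2 * (G.rootedSets U a).card
      ≤ 3 * ∑ S ∈ G.rootedSets U a, (S.card : ℝ) → G.IsPathRootedAt U a) ?_ ?_ U a hU ha h
  · intro a _
    refine ⟨a, Walk.nil, Walk.IsPath.nil, by simp, fun x hx => ?_⟩
    rw [Finset.mem_singleton] at hx
    subst hx
    rw [Finset.filter_eq_empty_iff.2]
    · simp
    · intro y hy
      rw [Finset.mem_singleton.1 hy]
      exact G.irrefl
  · intro D a c U₁ U₂ hD h₁ h₂ ha hc hU₁ hU₂ _ ih h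
    have b₁ : RootedBounds _ _ _ _ := hG.hasRootedBounds hU₁ ha
    have b₂ : RootedBounds _ _ _ _ := hG.hasRootedBounds hU₂ hc
    have b := b₁.merge_order_le b₂.extend
    rw [hD.card_rootedSets_union h₁ h₂, hD.order_rootedSets_union h₁ h₂,
      hD.card_avoidSets_union h₁ h₂] at h
    set F := ((G.rootedSets U₁ a).card : ℝ)
    set f := ((G.rootedSets U₂ c).card : ℝ)
    have hF := b₁.one_le
    have hf := b₂.one_le
    have z₁ := b₁.order_le
    have z₂ := b₂.order_le
    have hF1 : F = 1 := by
      by_contra hne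
      have hlt : 1 < F := lt_of_le_of_ne hF (Ne.symm hne)
      have : 0 < (F - 1) * (f + 1 - 1) * (F * (f + 1) - F / 2 - (f + 1) / 2) :=
        mul_pos (mul_pos (by linarith) (by linarith)) (by nlinarith)
      nlinarith
    have hUa : U₁ = {a} := eq_singleton_of_card_rootedSets_le hU₁ ha (by
      have : ((G.rootedSets U₁ a).card : ℝ) ≤ 1 := hF1.le
      exact_mod_cast this)
    -- With F = 1, `b` bounds Z of `U₂` by Z of the union.
    obtain ⟨u, p, hp, hsupp, hdeg⟩ := ih (by rw [hF1] at b z₁ h; nlinarith)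
    have haU₂ : a ∉ U₂ := fun h => hD.notMem (h₂ a h)
    have hau : a ≠ u := by
      rintro rfl
      exact haU₂ (hsupp _ p.start_mem_support)
    have hac : a ≠ c := hD.adj.ne
    subst hUa
    refine ⟨u, p.concat hD.adj.symm, hp.concat (fun h => haU₂ (hsupp _ h)) _, ?_, ?_⟩
    · intro x hx
      rw [Walk.support_concat, List.mem_append, List.mem_singleton] at hx
      rcases hx with hx | rfl
      · exact Finset.mem_union_right _ (hsupp x hx)
      · exact Finset.mem_union_left _ ha
    · intro x hx
      rw [Finset.filter_union, Finset.card_union_of_disjoint]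
      · rw [Finset.mem_union, Finset.mem_singleton] at hx
        rcases hx with rfl | hx
        · have e₁ : ({x} : Finset V).filter (fun y => G.Adj x y) = ∅ := by
            simp [Finset.filter_singleton]
          have e₂ : U₂.filter (fun y => G.Adj x y) = {c} := by
            ext y
            rw [Finset.mem_filter, Finset.mem_singleton]
            refine ⟨fun h => (hD.eq_of_adj x hD.notMem y (h₂ y h.1) h.2).2, ?_⟩
            rintro rfl
            exact ⟨hc, hD.adj⟩
          rw [e₁, e₂, if_neg hau, if_pos rfl]
          simp
        · have hxa : x ≠ a := fun h => haU₂ (h ▸ hx)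
          have := hdeg x hx
          -- The edge ac replaces the correction that c had as the end of the shorter path.
          have e : (({a} : Finset V).filter (fun y => G.Adj x y)).card = if x = c then 1 else 0 := by
            rw [Finset.filter_singleton]
            split_ifs with h₃ h₄ h₄
            · rfl
            · exact absurd (hD.eq_of_adj a hD.notMem x (h₂ x hx) h₃.symm).2 h₄
            · exact absurd (h₄ ▸ hD.adj.symm) h₃
            · rfl
          rw [e, if_neg hxa]
          omega
      · rw [Finset.disjoint_left]
        intro y hy hy'
        rw [Finset.mem_filter, Finset.mem_singleton] at hy
        exact haU₂ (hy.1 ▸ (Finset.mem_filter.1 hy').1)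

end Rooted

end SimpleGraph

namespace SimpleGraph

/-! ### Mean subtree order through connected sets. -/

section MeanOrder

variable {V : Type*} {G : SimpleGraph V}

theorem IsAcyclic.subtrees_eq [Fintype V] (hG : G.IsAcyclic) :
    G.subtrees = (fun S : Finset V => (⊤ : G.Subgraph).induce (S : Set V)) ''
      (G.connSets Finset.univ : Set (Finset V)) := by
  classical
  ext H
  rw [Set.mem_image]
  constructor
  · intro hH
    refine ⟨H.verts.toFinset, ?_, ?_⟩
    · rw [Finset.mem_coe, mem_connSets, Set.coe_toFinset]
      exact ⟨Finset.subset_univ _, Connected.connectedOn_verts hH.connected⟩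
    · rw [Set.coe_toFinset]
      exact hG.eq_induce_verts hH.connected
  · rintro ⟨S, hS, rfl⟩
    exact ⟨(mem_connSets.1 hS).2.connected_induce, hG.subgraph _⟩

theorem IsAcyclic.meanSubtreeOrder_eq [Fintype V] (hG : G.IsAcyclic) :
    G.meanSubtreeOrder = (∑ S ∈ G.connSets Finset.univ, (S.card : ℝ))
      / ((G.connSets Finset.univ).card : ℝ) := by
  have hinj : Function.Injective
      (fun S : Finset V => (⊤ : G.Subgraph).induce (S : Set V)) := fun S S' h =>
    Finset.coe_injective (congrArg Subgraph.verts h)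
  rw [meanSubtreeOrder, hG.subtrees_eq, finsum_mem_image hinj.injOn,
    Set.ncard_image_of_injective _ hinj, Set.ncard_coe_finset, finsum_mem_coe_finset]
  simp [Set.ncard_coe_finset]

end MeanOrder

/-! ### From a rooted path on one side of the cut to a pendant path. -/

section PendantPath

open scoped Classical

variable {V : Type*} [Fintype V] {G : SimpleGraph V} {D : Set V} {a c : V}

theorem IsEdgeCut.liesOnPendantPath [G.LocallyFinite] (hD : G.IsEdgeCut D a c)
    (h : G.IsPathRootedAt (Finset.univ.filter (· ∉ D)) a) : G.LiesOnPendantPath s(a, c) := by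
  obtain ⟨u, p, hp, hsupp, hdeg⟩ := h
  -- Off D, passing to degrees in `G` adds only the neighbour c of a, which cancels the correction
  -- at a.
  have hdeg' : ∀ x ∉ D, G.degree x + (if x = u then 1 else 0) = 2 := by
    intro x hx
    have h₁ := hdeg x (Finset.mem_filter.2 ⟨Finset.mem_univ x, hx⟩)
    have e : G.degree x = ((Finset.univ.filter (· ∉ D)).filter fun y => G.Adj x y).card
        + ((Finset.univ.filter (· ∈ D)).filter fun y => G.Adj x y).card := by
      rw [← card_neighborFinset_eq_degree, ← Finset.card_union_of_disjoint]
      · congr 1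
        ext y
        by_cases hy : y ∈ D <;> simp [hy]
      · rw [Finset.disjoint_left]
        intro y hy hy'
        simp only [Finset.mem_filter] at hy hy'
        exact hy.1.2 hy'.1.2
    have e' : ((Finset.univ.filter (· ∈ D)).filter fun y => G.Adj x y).card
        = if x = a then 1 else 0 := by
      split_ifs with hxa
      · rw [Finset.card_eq_one]
        refine ⟨c, ?_⟩
        ext y
        simp only [Finset.mem_filter, Finset.mem_univ, true_and, Finset.mem_singleton]
        constructor
        · exact fun hy => (hD.eq_of_adj x hx y hy.1 hy.2).2
        · rintro rfl
          exact ⟨hD.mem, hxa ▸ hD.adj⟩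
      · rw [Finset.card_eq_zero, Finset.filter_eq_empty_iff]
        exact fun y hy hxy => hxa (hD.eq_of_adj x hx y (Finset.mem_filter.1 hy).2 hxy).1
    omega
  have hsupp' : ∀ x ∈ p.support, x ∉ D := fun x hx => (Finset.mem_filter.1 (hsupp x hx)).2
  refine ⟨u, c, p.concat hD.adj, hp.concat (fun h => hsupp' c h hD.mem) _, ?_, ?_, ?_⟩
  · have := hdeg' u (hsupp' u p.start_mem_support)
    rw [if_pos rfl] at this
    omega
  · intro x hx hxu hxc
    rw [Walk.support_concat, List.mem_append, List.mem_singleton] at hx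
    have := hdeg' x (hsupp' x (hx.resolve_right hxc))
    rwa [if_neg hxu] at this
  · rw [Walk.edges_concat, List.concat_eq_append]
    simp

end PendantPath

/-! ### Subtrees of the contracted tree. -/

section Contraction

open scoped Classical

variable {V W : Type*} {G : SimpleGraph V} {a c : V} {q : V → W}

/-- The map `q` identifies `a` and `c` and nothing else. -/
structure IsIdentification (q : V → W) (a c : V) : Prop where
  surj : Function.Surjective q
  eq_iff : ∀ x y, q x = q y ↔ x = y ∨ ((x = a ∨ x = c) ∧ (y = a ∨ y = c))

theorem isIdentification_mk (a c : V) :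
    IsIdentification (Quotient.mk (identifyEnds s(a, c))) a c := by
  refine ⟨Quotient.mk_surjective, fun x y => ?_⟩
  rw [Quotient.eq]
  change x = y ∨ (x ∈ s(a, c) ∧ y ∈ s(a, c)) ↔ _
  rw [Sym2.mem_iff, Sym2.mem_iff]

theorem IsIdentification.injOn (hq : IsIdentification q a c) {S : Set V}
    (h : ¬ (a ∈ S ∧ c ∈ S)) : Set.InjOn q S := by
  intro x hx y hy hxy
  rcases (hq.eq_iff x y).1 hxy with h' | ⟨rfl | rfl, rfl | rfl⟩
  · exact h'
  · rfl
  · exact absurd ⟨hx, hy⟩ h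
  · exact absurd ⟨hy, hx⟩ h
  · rfl

theorem IsIdentification.card_image_add_one (hq : IsIdentification q a c) (hac : a ≠ c)
    {S : Finset V} (ha : a ∈ S) (hc : c ∈ S) : (S.image q).card + 1 = S.card := by
  have e : S.image q = (S.erase c).image q := by
    refine Finset.Subset.antisymm (fun w hw => ?_) (Finset.image_subset_image (S.erase_subset c))
    obtain ⟨x, hx, rfl⟩ := Finset.mem_image.1 hw
    by_cases hxc : x = c
    · refine Finset.mem_image.2 ⟨a, Finset.mem_erase.2 ⟨hac, ha⟩, ?_⟩
      exact (hq.eq_iff a x).2 (Or.inr ⟨Or.inl rfl, Or.inr hxc⟩)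
    · exact Finset.mem_image.2 ⟨x, Finset.mem_erase.2 ⟨hxc, hx⟩, rfl⟩
  rw [e, Finset.card_image_of_injOn, Finset.card_erase_add_one hc]
  exact hq.injOn fun h => (Finset.mem_erase.1 h.2).1 rfl

theorem ConnectedOn.image_map {S : Set V} (hS : G.ConnectedOn S) (q : V → W) :
    (G.map q).ConnectedOn (q '' S) := by
  refine hS.image q fun x _ y _ hxy => ?_
  by_cases h : q x = q y
  · exact Or.inl h
  · exact Or.inr ⟨h, x, y, hxy, rfl, rfl⟩

theorem IsIdentification.connectedOn_preimage (hq : IsIdentification q a c) (hac : G.Adj a c)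
    {S : Set W} (hS : (G.map q).ConnectedOn S) : G.ConnectedOn (q ⁻¹' S) := by
  obtain ⟨⟨w, hw⟩, hS⟩ := hS
  obtain ⟨v, rfl⟩ := hq.surj w
  refine ⟨⟨v, hw⟩, fun X ⟨x, hx, hxX⟩ hcl => ?_⟩
  -- X is a union of fibres inside the preimage, because the only nontrivial fibre {a, c} is an
  -- edge.
  have fiber : ∀ u ∈ X, ∀ v, q u ∈ S → q u = q v → v ∈ X := by
    intro u hu v huS huv
    have hvS : q v ∈ S := huv ▸ huS
    rcases (hq.eq_iff u v).1 huv with rfl | ⟨rfl | rfl, rfl | rfl⟩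
    · exact hu
    · exact hu
    · exact hcl _ huS hu _ hvS hac
    · exact hcl _ huS hu _ hvS hac.symm
    · exact hu
  have := hS (q '' X) ⟨q x, hx, x, hxX, rfl⟩ ?_
  · intro y hy
    obtain ⟨z, hz, hzy⟩ := this hy
    refine fiber z hz y ?_ hzy
    rw [hzy]
    exact hy
  · rintro _ hwS ⟨z, hz, rfl⟩ _ hwS' ⟨-, u, v, huv, hu, rfl⟩
    have hu' : u ∈ X := fiber z hz u hwS hu.symm
    refine ⟨v, hcl u ?_ hu' v hwS' huv, rfl⟩
    rw [Set.mem_preimage, hu]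
    exact hwS

theorem IsIdentification.isTree_map [Fintype V] [Fintype W] (hq : IsIdentification q a c)
    (hac : G.Adj a c) (hG : G.IsTree) : (G.map q).IsTree := by
  have hconn : (G.map q).Connected := by
    refine ConnectedOn.connected ?_
    rw [← hq.surj.range_eq, ← Set.image_univ]
    exact hG.connected.connectedOn_univ.image_map q
  refine isTree_iff_connected_and_card.2 ⟨hconn, ?_⟩
  -- Contraction loses one vertex and at least one edge, since ac would become a loop; connectedness
  -- gives the reverse inequality.
  refine le_antisymm ?_ hconn.card_vert_le_card_edgeSet_add_one
  have hV : Nat.card W + 1 = Nat.card V := by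
    have := hq.card_image_add_one hac.ne (Finset.mem_univ a) (Finset.mem_univ c)
    rwa [Finset.image_univ_of_surjective hq.surj, Finset.card_univ, Finset.card_univ,
      ← Nat.card_eq_fintype_card, ← Nat.card_eq_fintype_card] at this
  have hE := (isTree_iff_connected_and_card.1 hG).2
  have hsub : (G.map q).edgeSet ⊆ Sym2.map q '' (G.edgeSet \ {s(a, c)}) := by
    intro e
    induction e with
    | _ x y =>
      rintro ⟨hne, u, v, huv, rfl, rfl⟩
      refine ⟨s(u, v), ⟨huv, fun h => hne ?_⟩, rfl⟩
      rcases Sym2.eq_iff.1 (Set.mem_singleton_iff.1 h) with ⟨rfl, rfl⟩ | ⟨rfl, rfl⟩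
      · exact (hq.eq_iff _ _).2 (Or.inr ⟨Or.inl rfl, Or.inr rfl⟩)
      · exact (hq.eq_iff _ _).2 (Or.inr ⟨Or.inr rfl, Or.inl rfl⟩)
  have h₁ := Set.ncard_le_ncard hsub (Set.toFinite _)
  have h₂ := Set.ncard_image_le (f := Sym2.map q) (Set.toFinite (G.edgeSet \ {s(a, c)}))
  have h₃ := Set.ncard_sdiff_singleton_add_one (show s(a, c) ∈ G.edgeSet from hac)
    (Set.toFinite _)
  rw [Nat.card_coe_set_eq] at hE ⊢
  omega

theorem IsIdentification.sum_connSets_map [Fintype V] [Fintype W] (hq : IsIdentification q a c)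
    (hac : G.Adj a c) (h : Finset W → ℝ) :
    ∑ S ∈ (G.map q).connSets Finset.univ, h S
      = ∑ S ∈ (G.connSets Finset.univ).filter (fun S => a ∈ S ↔ c ∈ S), h (S.image q) := by
  have hqac : q a = q c := (hq.eq_iff a c).2 (Or.inr ⟨Or.inl rfl, Or.inr rfl⟩)
  symm
  refine Finset.sum_bij' (fun S _ => S.image q) (fun S _ => Finset.univ.filter (fun v => q v ∈ S))
    ?_ ?_ ?_ ?_ fun _ _ => rfl
  · intro S hS
    rw [Finset.mem_filter, mem_connSets] at hS
    rw [mem_connSets, Finset.coe_image]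
    exact ⟨Finset.subset_univ _, hS.1.2.image_map q⟩
  · intro S hS
    rw [mem_connSets] at hS
    rw [Finset.mem_filter, mem_connSets]
    refine ⟨⟨Finset.subset_univ _, ?_⟩, by simp [hqac]⟩
    convert hq.connectedOn_preimage hac hS.2 using 1
    ext v; simp
  · intro S hS
    ext v
    rw [Finset.mem_filter] at hS
    simp only [Finset.mem_filter, Finset.mem_univ, true_and, Finset.mem_image]
    constructor
    · rintro ⟨u, hu, huv⟩
      rcases (hq.eq_iff u v).1 huv with rfl | ⟨rfl | rfl, rfl | rfl⟩
      · exact hu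
      · exact hu
      · exact hS.2.1 hu
      · exact hS.2.2 hu
      · exact hu
    · exact fun hv => ⟨v, hv, rfl⟩
  · intro S _
    ext w
    simp only [Finset.mem_filter, Finset.mem_univ, true_and, Finset.mem_image]
    constructor
    · rintro ⟨v, hv, rfl⟩
      exact hv
    · obtain ⟨v, rfl⟩ := hq.surj w
      exact fun hv => ⟨v, hv, rfl⟩

theorem IsEdgeCut.sum_connSets_filter_union {D : Set V} (hD : G.IsEdgeCut D a c)
    {U₁ U₂ : Finset V} (h₁ : ∀ x ∈ U₁, x ∉ D) (h₂ : ∀ x ∈ U₂, x ∈ D) (h : Finset V → ℝ) :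
    ∑ S ∈ (G.connSets (U₁ ∪ U₂)).filter (fun S => a ∈ S ↔ c ∈ S), h S
      = ∑ S ∈ G.avoidSets U₁ a, h S + ∑ S ∈ G.avoidSets U₂ c, h S
        + ∑ S ∈ G.rootedSets U₁ a, ∑ S' ∈ G.rootedSets U₂ c, h (S ∪ S') := by
  rw [Finset.sum_filter, hD.sum_connSets_union h₁ h₂]
  congr 1
  · congr 1
    · rw [avoidSets, Finset.sum_filter]
      refine Finset.sum_congr rfl fun S hS => ?_
      have hc : c ∉ S := fun hc => h₁ c ((mem_connSets.1 hS).1 hc) hD.mem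
      simp [hc]
    · rw [avoidSets, Finset.sum_filter]
      refine Finset.sum_congr rfl fun S hS => ?_
      have ha : a ∉ S := fun ha => hD.notMem (h₂ a ((mem_connSets.1 hS).1 ha))
      simp [ha]
  · refine Finset.sum_congr rfl fun S hS => Finset.sum_congr rfl fun S' hS' => if_pos ?_
    exact iff_of_true (Finset.mem_union_left _ (mem_rootedSets.1 hS).2)
      (Finset.mem_union_right _ (mem_rootedSets.1 hS').2)

theorem mem_avoidSets {U S : Finset V} :
    S ∈ G.avoidSets U a ↔ (S ⊆ U ∧ G.ConnectedOn (S : Set V)) ∧ a ∉ S := by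
  simp [avoidSets, mem_connSets]

theorem IsIdentification.sum_card_connSets_map [Fintype V] [Fintype W] {D : Set V}
    (hq : IsIdentification q a c) (hD : G.IsEdgeCut D a c) {U₁ U₂ : Finset V}
    (h₁ : ∀ x ∈ U₁, x ∉ D) (h₂ : ∀ x ∈ U₂, x ∈ D) (hU : U₁ ∪ U₂ = Finset.univ) :
    ∑ S ∈ (G.map q).connSets Finset.univ, (S.card : ℝ)
      = ∑ S ∈ G.avoidSets U₁ a, (S.card : ℝ) + ∑ S ∈ G.avoidSets U₂ c, (S.card : ℝ)
        + ((∑ S ∈ G.rootedSets U₁ a, (S.card : ℝ)) * (G.rootedSets U₂ c).card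
        + (G.rootedSets U₁ a).card * ∑ S ∈ G.rootedSets U₂ c, (S.card : ℝ)
        - (G.rootedSets U₁ a).card * (G.rootedSets U₂ c).card) := by
  rw [hq.sum_connSets_map hD.adj, ← hU, hD.sum_connSets_filter_union h₁ h₂]
  congr 1
  · congr 1
    · refine Finset.sum_congr rfl fun S hS => ?_
      rw [Finset.card_image_of_injOn (hq.injOn fun h => (mem_avoidSets.1 hS).2 h.1)]
    · refine Finset.sum_congr rfl fun S hS => ?_
      rw [Finset.card_image_of_injOn (hq.injOn fun h => (mem_avoidSets.1 hS).2 h.2)]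
  · rw [← sum_rootedSets_card_union h₁ h₂, eq_sub_iff_add_eq, ← nsmul_eq_mul, ← Finset.sum_const,
      ← Finset.sum_add_distrib]
    refine Finset.sum_congr rfl fun S hS => ?_
    rw [← nsmul_one, ← Finset.sum_const, ← Finset.sum_add_distrib]
    refine Finset.sum_congr rfl fun S' hS' => ?_
    have := hq.card_image_add_one hD.adj.ne
      (Finset.mem_union_left S' (mem_rootedSets.1 hS).2)
      (Finset.mem_union_right S (mem_rootedSets.1 hS').2)
    exact_mod_cast this

theorem IsIdentification.card_connSets_map [Fintype V] [Fintype W] {D : Set V}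
    (hq : IsIdentification q a c) (hD : G.IsEdgeCut D a c) {U₁ U₂ : Finset V}
    (h₁ : ∀ x ∈ U₁, x ∉ D) (h₂ : ∀ x ∈ U₂, x ∈ D) (hU : U₁ ∪ U₂ = Finset.univ) :
    (((G.map q).connSets Finset.univ).card : ℝ)
      = (G.avoidSets U₁ a).card + (G.avoidSets U₂ c).card
        + (G.rootedSets U₁ a).card * (G.rootedSets U₂ c).card := by
  have := hq.sum_connSets_map hD.adj (fun _ => 1)
  rw [← hU, hD.sum_connSets_filter_union h₁ h₂] at this
  simpa using this

theorem IsTree.one_third_lt_of_isIdentification [Fintype V] [Fintype W] {D : Set V}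
    (hG : G.IsTree) (hq : IsIdentification q a c) (hD : G.IsEdgeCut D a c)
    (ha : ¬ G.IsPathRootedAt (Finset.univ.filter (· ∉ D)) a)
    (hc : ¬ G.IsPathRootedAt (Finset.univ.filter (· ∈ D)) c) :
    1 / 3 < G.meanSubtreeOrder - (G.map q).meanSubtreeOrder := by
  have hconn := hG.connected.connectedOn_univ
  rw [hG.isAcyclic.meanSubtreeOrder_eq, (hq.isTree_map hD.adj hG).isAcyclic.meanSubtreeOrder_eq]
  set A : Finset V := Finset.univ.filter (· ∉ D)
  set B : Finset V := Finset.univ.filter (· ∈ D)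
  have h₁ : ∀ x ∈ A, x ∉ D := fun x hx => (Finset.mem_filter.1 hx).2
  have h₂ : ∀ x ∈ B, x ∈ D := fun x hx => (Finset.mem_filter.1 hx).2
  have hU : A ∪ B = Finset.univ := by
    rw [Finset.union_comm, Finset.filter_union_filter_not_eq]
  have hA : G.ConnectedOn (A : Set V) := by
    convert hconn.diff hD trivial using 1
    ext z; simp [A]
  have hB : G.ConnectedOn (B : Set V) := by
    convert hconn.inter hD trivial using 1
    ext z; simp [B]
  have haA : a ∈ A := Finset.mem_filter.2 ⟨Finset.mem_univ a, hD.notMem⟩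
  have hcB : c ∈ B := Finset.mem_filter.2 ⟨Finset.mem_univ c, hD.mem⟩
  have bA : RootedBounds _ _ _ _ := hG.isAcyclic.hasRootedBounds hA haA
  have bB : RootedBounds _ _ _ _ := hG.isAcyclic.hasRootedBounds hB hcB
  have zA := not_le.1 (mt (hG.isAcyclic.isPathRootedAt hA haA) ha)
  have zB := not_le.1 (mt (hG.isAcyclic.isPathRootedAt hB hcB) hc)
  have hR := hD.sum_connSets_union h₁ h₂ (fun S => (S.card : ℝ))
  have hN := hD.sum_connSets_union h₁ h₂ (fun _ => 1)
  rw [sum_rootedSets_card_union h₁ h₂, ← sum_rootedSets_add_sum_avoidSets A a,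
    ← sum_rootedSets_add_sum_avoidSets B c] at hR
  rw [← sum_rootedSets_add_sum_avoidSets A a, ← sum_rootedSets_add_sum_avoidSets B c] at hN
  simp only [Finset.sum_const, nsmul_eq_mul, mul_one] at hN
  rw [hU] at hR hN
  rw [hq.sum_card_connSets_map hD h₁ h₂ hU, hq.card_connSets_map hD h₁ h₂ hU, hR, hN]
  set F := ((G.rootedSets A a).card : ℝ)
  set f := ((G.rootedSets B c).card : ℝ)
  -- If f = 1 then g = 0 and p ≥ 1, so Z of B is not positive, against `zB`.
  have hf : 1 < f := by
    refine lt_of_le_of_ne bB.one_le fun hf => ?_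
    have k₁ := bB.avoid_le
    have k₂ := bB.le_order
    have k₃ := bB.nonneg
    rw [← hf] at k₁ k₂ zB
    linarith
  have key := bA.contract_lt bB zA hf
  have hF0 := bA.one_le
  have hG0 := bA.nonneg
  have hg0 := bB.nonneg
  have hFf : 0 < F * f := mul_pos (by linarith) (by linarith)
  rw [div_sub_div _ _ (by linarith) (by linarith), div_lt_div_iff₀ (by norm_num)
    (mul_pos (by linarith) (by linarith))]
  linarith

end Contraction

end SimpleGraph

/-! ### The theorem. -/

theorem theorem1 {V : Type*} [Fintype V] (T : SimpleGraph V) [DecidableRel T.Adj]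
    (hT : T.IsTree) (e : Sym2 V) (he : e ∈ T.edgeSet) (hp : ¬ T.LiesOnPendantPath e) :
    T.meanSubtreeOrder - (T.contractEdge e).meanSubtreeOrder > 1 / 3 := by
  classical
  induction e with
  | _ a c =>
    obtain ⟨D, hD⟩ := hT.isAcyclic.exists_isEdgeCut (SimpleGraph.mem_edgeSet T |>.1 he)
    refine hT.one_third_lt_of_isIdentification (SimpleGraph.isIdentification_mk a c) hD
      (fun h => hp ?_) (fun h => hp ?_)
    · convert hD.liesOnPendantPath (by convert h)
    · rw [Sym2.eq_swap]
      convert hD.symm.liesOnPendantPath (by convert h; simp)
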